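/- Call an ultrafilter $\mathcal U$ on $\omega$ \emph{selective} if for every $f:\omega\to\omega$ there is $A\in\mathcal U$ such that $f$ is constant or one-to-one on $A$. For ultrafilters $\mathcal F,\mathcal G$ on $\omega$ write $\mathcal F\le_{RK}\mathcal G$ if there is $f:\omega\to\omega$ with $\mathcal F=\{A\subseteq\omega: f^{-1}(A)\in\mathcal G\}$, and $\mathcal F\equiv_{RK}\mathcal G$ ($\mathcal F$ and $\mathcal G$ are RK-isomorphic) if $\mathcal F\le_{RK}\mathcal G$ and $\mathcal G\le_{RK}\mathcal F$. Let $\mathbb T'=\bigcup_{l\in\omega}\prod_{k<l}2^{k}$, where $2^k$ is the set of functions from $k=\{0,\dots,k-1\}$ to $2=\{0,1\}$. For $k,l\in\omega$, a set $A\subseteq 2^{l}$ is \emph{$k$-big} if for every $\sigma:k\to 2$ there is $\tau\in A$ with $\sigma\subseteq\tau$. Given a selective ultrafilter $\mathcal U$ on $\omega$, let $\mathbb P(\mathcal U)$ be the set of all $T\subseteq\mathbb T'$ that are closed under initial segments and satisfy: 1. $\emptyset\in T$; 2. for all $f\in T$ and all $n<\omega$ with $n\ge\operatorname{dom}(f)$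 there is $g\in T$ with $f\subseteq g$ and $\operatorname{dom}(g)\ge n$; 3. for each $k\in\omega$, the set of all $l\in\omega$ such that for every $f\in T$ with $\operatorname{dom}(f)=l$ the set $\{\sigma\in 2^{l}: f^\frown\langle\sigma\rangle\in T\}$ is $k$-big, belongs to $\mathcal U$. Order $\mathbb P(\mathcal U)$ by inclusion: $S\le T$ if and only if $S\subseteq T$. A forcing notion $\mathbb P$ \emph{preserves} an ultrafilter $\mathcal V$ on $\omega$ if every condition of $\mathbb P$ forces that $\{A\subseteq\omega:\exists B\in\mathcal V\,(B\subseteq A)\}$ is an ultrafilter on $\omega$. **Lemma.** Let $\mathcal U$ and $\mathcal V$ be selective ultrafilters on $\omega$ with $\mathcal V\not\equiv_{RK}\mathcal U$. Then $\mathbb P(\mathcal U)$ preserves $\mathcal V$. -/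

import Mathlib

/-! ### Ultrafilters on the natural numbers -/

/-- An ultrafilter on `ℕ` is selective if every function `ℕ → ℕ` is constant or one-to-one on a
member of it. -/
def IsSelective (U : Ultrafilter ℕ) : Prop :=
  ∀ f : ℕ → ℕ, ∃ A ∈ U, (∃ c, ∀ n ∈ A, f n = c) ∨ Set.InjOn f A

/-- The Rudin-Keisler order: `F = {A | f ⁻¹' A ∈ G}` for some function `f`. -/
def RKLE {X Y : Type*} (F : Ultrafilter X) (G : Ultrafilter Y) : Prop :=
  ∃ f : Y → X, ∀ A : Set X, A ∈ F ↔ f ⁻¹' A ∈ G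

/-- Rudin-Keisler equivalence (for ultrafilters on `ℕ`: being RK-isomorphic). -/
def RKEquiv {X Y : Type*} (F : Ultrafilter X) (G : Ultrafilter Y) : Prop :=
  RKLE F G ∧ RKLE G F

/-! ### Forcing: names, the forcing relation, preservation of an ultrafilter -/

/-- `P`-names: a name is a set of pairs (name, condition), here an indexed family of them. -/
inductive PName (P : Type) : Type 1
  | mk (ι : Type) (elt : ι → PName P) (cond : ι → P) : PName P

namespace PName

/-- The canonical name of a ground model set `x`: the set of all pairs `(canonical name of y, p)`
with `y ∈ x` and `p` a condition.  (No largest condition is needed.) -/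
def check (P : Type) : PSet.{0} → PName P
  | PSet.mk α A => PName.mk (α × P) (fun i => check P (A i.1)) (fun i => i.2)

/-- `forcesEq a b p` says that `p` forces `a = b`. -/
def forcesEq {P : Type} [Preorder P] : PName P → PName P → P → Prop
  | PName.mk ι a s, PName.mk κ b t => fun p =>
    (∀ i : ι, ∀ q, q ≤ p → q ≤ s i → ∃ r, r ≤ q ∧ ∃ j : κ, r ≤ t j ∧ forcesEq (a i) (b j) r) ∧
    (∀ j : κ, ∀ q, q ≤ p → q ≤ t j → ∃ r, r ≤ q ∧ ∃ i : ι, r ≤ s i ∧ forcesEq (a i) (b j) r)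

/-- `forcesMem a b p` says that `p` forces `a ∈ b`. -/
def forcesMem {P : Type} [Preorder P] (a : PName P) : PName P → P → Prop
  | PName.mk κ b t => fun p =>
    ∀ q, q ≤ p → ∃ r, r ≤ q ∧ ∃ j : κ, r ≤ t j ∧ forcesEq a (b j) r

end PName

/-- Sentences of the forcing language: set-theoretic sentences with `P`-names as constants.
Quantifiers range over all `P`-names. -/
inductive ForcingSentence (P : Type) : Type 1
  | eq (a b : PName P) : ForcingSentence P
  | mem (a b : PName P) : ForcingSentence P
  | neg (φ : ForcingSentence P) : ForcingSentence P
  | and (φ ψ : ForcingSentence P) : ForcingSentence P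
  | or (φ ψ : ForcingSentence P) : ForcingSentence P
  | imp (φ ψ : ForcingSentence P) : ForcingSentence P
  | all (φ : PName P → ForcingSentence P) : ForcingSentence P
  | ex (φ : PName P → ForcingSentence P) : ForcingSentence P

/-- The forcing relation; `Forces φ p` says that the condition `p` forces `φ`
(smaller conditions are stronger). -/
def Forces {P : Type} [Preorder P] : ForcingSentence P → P → Prop
  | .eq a b => fun p => PName.forcesEq a b p
  | .mem a b => fun p => PName.forcesMem a b p
  | .neg φ => fun p => ∀ q, q ≤ p → ¬ Forces φ q
  | .and φ ψ => fun p => Forces φ p ∧ Forces ψ p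
  | .or φ ψ => fun p => ∀ q, q ≤ p → ∃ r, r ≤ q ∧ (Forces φ r ∨ Forces ψ r)
  | .imp φ ψ => fun p => ∀ q, q ≤ p → Forces φ q → Forces ψ q
  | .all φ => fun p => ∀ a, Forces (φ a) p
  | .ex φ => fun p => ∀ q, q ≤ p → ∃ r, r ≤ q ∧ ∃ a, Forces (φ a) r

namespace ForcingSentence

/-- The sentence `a ⊆ b`. -/
def sub {P : Type} (a b : PName P) : ForcingSentence P :=
  .all fun n => .imp (.mem n a) (.mem n b)

/-- The sentence "`d` is the intersection of `a` and `b`". -/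
def isInter {P : Type} (a b d : PName P) : ForcingSentence P :=
  .all fun n => .and (.imp (.mem n d) (.and (.mem n a) (.mem n b)))
    (.imp (.and (.mem n a) (.mem n b)) (.mem n d))

/-- The sentence "`c` is the complement of `a` in `w`". -/
def isCompl {P : Type} (w a c : PName P) : ForcingSentence P :=
  .all fun n => .and (.imp (.mem n c) (.and (.mem n w) (.neg (.mem n a))))
    (.imp (.and (.mem n w) (.neg (.mem n a))) (.mem n c))

/-- Given a predicate `S` on names, the sentence "the `A` satisfying `S` form an ultrafilter on
`w`": they are subsets of `w`; `w` is one of them and the empty set is not; they are closed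
under supersets within `w` and under intersections; and for each `A ⊆ w`, `A` or its complement is
one of them. -/
def isUltrafilterOn {P : Type} (w : PName P) (S : PName P → ForcingSentence P) :
    ForcingSentence P :=
  .and (.all fun A => .imp (S A) (sub A w)) <|
  .and (S w) <|
  .and (.all fun A => .imp (.all fun n => .neg (.mem n A)) (.neg (S A))) <|
  .and (.all fun A => .all fun D => .imp (.and (S A) (.and (sub A D) (sub D w))) (S D)) <|
  .and (.all fun A => .all fun B => .all fun D =>
    .imp (.and (.and (S A) (S B)) (isInter A B D)) (S D)) <|
  .all fun A => .all fun C => .imp (.and (sub A w) (isCompl w A C)) (.or (S A) (S C))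

end ForcingSentence

/-- The ground model set of (von Neumann) natural numbers coded by `A : Set ℕ`. -/
def natSubset (A : Set ℕ) : PSet.{0} :=
  PSet.mk {n : ℕ // n ∈ A} fun n => PSet.ofNat n.1

/-- The ultrafilter `V` as a ground model set of subsets of `ω`. -/
def ultrafilterSet (V : Ultrafilter ℕ) : PSet.{0} :=
  PSet.mk {A : Set ℕ // A ∈ V} fun A => natSubset A.1

/-- The sentence "`A ⊆ ω` and `B ⊆ A` for some `B ∈ V`". -/
def memGenerated (P : Type) (V : Ultrafilter ℕ) (A : PName P) : ForcingSentence P :=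
  .and (.sub A (PName.check P PSet.omega))
    (.ex fun B => .and (.mem B (PName.check P (ultrafilterSet V))) (.sub B A))

/-- The forcing notion `P` preserves the ultrafilter `V` on `ω`: every condition forces that
`{A ⊆ ω | ∃ B ∈ V, B ⊆ A}` is an ultrafilter on `ω`. -/
def Preserves (P : Type) [Preorder P] (V : Ultrafilter ℕ) : Prop :=
  ∀ p : P, Forces
    (ForcingSentence.isUltrafilterOn (PName.check P PSet.omega) (memGenerated P V)) p

/-! ### The forcing `ℙ(𝓤)` -/

/-- `A ⊆ 2^l` is `k`-big if every `σ : k → 2` is extended by some `τ ∈ A`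
(which includes that `k ≤ l`). -/
def IsBig {l : ℕ} (k : ℕ) (A : Set (Fin l → Bool)) : Prop :=
  ∀ σ : Fin k → Bool, ∃ τ ∈ A, ∃ h : k ≤ l, ∀ i : Fin k, τ (Fin.castLE h i) = σ i

/-- The `l`-th level `∏_{k < l} 2^k` of the tree `𝕋' = ⋃_l ∏_{k < l} 2^k`. -/
abbrev TreeNode (l : ℕ) : Type := (k : Fin l) → (Fin (k : ℕ) → Bool)

/-- The restriction of `g ∈ ∏_{k < m} 2^k` to a smaller domain. -/
def TreeNode.restrict {l m : ℕ} (h : l ≤ m) (g : TreeNode m) : TreeNode l :=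
  fun k => g (Fin.castLE h k)

/-- `f ⌢ ⟨σ⟩` for `f ∈ ∏_{k < l} 2^k` and `σ ∈ 2^l`. -/
def TreeNode.append {l : ℕ} (f : TreeNode l) (σ : Fin l → Bool) : TreeNode (l + 1) :=
  Fin.snoc (α := fun k : Fin (l + 1) => Fin (k : ℕ) → Bool) f σ

/-- The set of immediate successors `{σ | f ⌢ ⟨σ⟩ ∈ T}`; a subset `T` of `𝕋'` is given by the
family of its levels. -/
def treeSucc (T : (l : ℕ) → Set (TreeNode l)) {l : ℕ} (f : TreeNode l) : Set (Fin l → Bool) :=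
  {σ | f.append σ ∈ T (l + 1)}

/-- The `𝓤`-conditions, i.e. the elements of `ℙ(𝓤)`. -/
structure UCondition (U : Ultrafilter ℕ) : Type where
  /-- The levels of the tree. -/
  tree : (l : ℕ) → Set (TreeNode l)
  downward_closed : ∀ {l m : ℕ} (h : l ≤ m), ∀ g ∈ tree m, g.restrict h ∈ tree l
  root_mem : (fun k => k.elim0 : TreeNode 0) ∈ tree 0
  extend : ∀ l, ∀ f ∈ tree l, ∀ n, l ≤ n →
    ∃ m, ∃ h : l ≤ m, n ≤ m ∧ ∃ g ∈ tree m, g.restrict h = f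
  big : ∀ k, {l : ℕ | ∀ f ∈ tree l, IsBig k (treeSucc tree f)} ∈ U

/-- `q ≤ p` if and only if the tree of `q` is contained in the tree of `p`. -/
instance (U : Ultrafilter ℕ) : Preorder (UCondition U) where
  le q p := ∀ l, q.tree l ⊆ p.tree l
  le_refl _ _ := subset_rfl
  le_trans _ _ _ h₁ h₂ l := (h₁ l).trans (h₂ l)

/-! ### The forcing relation -/

namespace PName

variable {P : Type} [Preorder P]

/-! Given a name `A` for a set of naturals and a condition `p`, it suffices to find `r ≤ p` and `B ∈
V` such that either `r` forces every `b ∈ B` into `A`, or no extension of `r` forces any `b ∈ B`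
into `A` (`preserves_of_decides`). Suppose that the second alternative fails below `p` and that `V`
is nonprincipal. Then below every `r ≤ p`, for `V`-many `b` some extension of `r` forces `b` into
`A`.

The first alternative is then reached by a fusion whose stages are pairs `(T, F)`, the levels of `T`
up to `F` being frozen. At a stage `b` from a set in `V`, the finitely many cones above level `F`
are shrunk to force `b` into `A` and then glued (`exists_amalgam`). At a stage `a` from a set in
`U`, the nodes of level `a` have `F`-big successor sets, and freezing up to `a + 1` keeps them big
in the limit (`exists_fusion`).

Each pair allows only a set in `U` and a set in `V` as next stages, so the schedule must be
consistent with its own past (`exists_joint_selection`). Only finitely many pairs are reachable by a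
given time; selectivity therefore supplies sets whose late elements suit all of them, provided that
consecutive stages are far apart. Non-isomorphism keeps the stages from `U` away from those from `V`
(`exists_sparse`). -/

theorem forcesEq_mono {a b : PName P} {p q : P} (h : q ≤ p) (hp : forcesEq a b p) :
    forcesEq a b q := by
  cases a; cases b
  simp only [forcesEq] at hp ⊢
  exact ⟨fun i r hr => hp.1 i r (hr.trans h), fun j r hr => hp.2 j r (hr.trans h)⟩

theorem forcesMem_mono {a b : PName P} {p q : P} (h : q ≤ p) (hp : forcesMem a b p) :
    forcesMem a b q := by
  cases b
  exact fun r hr => hp r (hr.trans h)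

/-- Membership is itself a density condition. This later turns "forced densely below the glued tree"
into "forced by the glued tree". -/
theorem forcesMem_of_dense {a b : PName P} {p : P}
    (hp : ∀ q, q ≤ p → ∃ r, r ≤ q ∧ forcesMem a b r) : forcesMem a b p := by
  cases b
  intro q hq
  obtain ⟨r, hr, h⟩ := hp q hq
  obtain ⟨s, hs, h⟩ := h r le_rfl
  exact ⟨s, hs.trans hr, h⟩

theorem forcesEq_refl (a : PName P) (p : P) : forcesEq a a p := by
  induction a generalizing p with
  | mk ι a s ih =>
    simp only [forcesEq]
    exact ⟨fun i q _ hs => ⟨q, le_rfl, i, hs, ih i q⟩, fun i q _ hs => ⟨q, le_rfl, i, hs, ih i q⟩⟩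

theorem forcesEq_symm {a b : PName P} {p : P} (h : forcesEq a b p) : forcesEq b a p := by
  induction a generalizing b p with
  | mk ι a s ih =>
    cases b with
    | mk κ b t =>
      simp only [forcesEq] at h ⊢
      refine ⟨fun j q hq hs => ?_, fun i q hq hs => ?_⟩
      · obtain ⟨r, hr, i, hi, e⟩ := h.2 j q hq hs
        exact ⟨r, hr, i, hi, ih i e⟩
      · obtain ⟨r, hr, j, hj, e⟩ := h.1 i q hq hs
        exact ⟨r, hr, j, hj, ih i e⟩

theorem forcesEq_trans {a b c : PName P} {p : P} (hab : forcesEq a b p) (hbc : forcesEq b c p) :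
    forcesEq a c p := by
  induction a generalizing b c p with
  | mk ι a s ih =>
    cases b with
    | mk κ b t =>
      cases c with
      | mk μ c u =>
        simp only [forcesEq] at hab hbc ⊢
        refine ⟨fun i q hq hs => ?_, fun k q hq hs => ?_⟩
        · obtain ⟨r, hr, j, hj, e⟩ := hab.1 i q hq hs
          obtain ⟨r', hr', k, hk, e'⟩ := hbc.1 j r (hr.trans hq) hj
          exact ⟨r', hr'.trans hr, k, hk, ih i (forcesEq_mono hr' e) e'⟩
        · obtain ⟨r, hr, j, hj, e⟩ := hbc.2 k q hq hs
          obtain ⟨r', hr', i, hi, e'⟩ := hab.2 j r (hr.trans hq) hj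
          exact ⟨r', hr'.trans hr, i, hi, ih i e' (forcesEq_mono hr' e)⟩

theorem forcesMem_congr_left {a b c : PName P} {p : P} (hab : forcesEq a b p)
    (h : forcesMem a c p) : forcesMem b c p := by
  cases c
  intro q hq
  obtain ⟨r, hr, j, hj, e⟩ := h q hq
  exact ⟨r, hr, j, hj, forcesEq_trans (forcesEq_symm (forcesEq_mono (hr.trans hq) hab)) e⟩

theorem forcesMem_congr_right {a b c : PName P} {p : P} (hbc : forcesEq b c p)
    (h : forcesMem a b p) : forcesMem a c p := by
  cases b
  cases c
  simp only [forcesEq] at hbc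
  intro q hq
  obtain ⟨r, hr, j, hj, e⟩ := h q hq
  obtain ⟨r', hr', k, hk, e'⟩ := hbc.1 j r (hr.trans hq) hj
  exact ⟨r', hr'.trans hr, k, hk, forcesEq_trans (forcesEq_mono hr' e) e'⟩

theorem forcesMem_check_natSubset {a : PName P} {A : Set ℕ} {p : P} :
    forcesMem a (check P (natSubset A)) p ↔
      ∀ q, q ≤ p → ∃ r, r ≤ q ∧ ∃ n ∈ A, forcesEq a (check P (PSet.ofNat n)) r := by
  constructor
  · intro h q hq
    obtain ⟨r, hr, ⟨n, c⟩, -, e⟩ := h q hq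
    exact ⟨r, hr, n.1, n.2, e⟩
  · intro h q hq
    obtain ⟨r, hr, n, hn, e⟩ := h q hq
    exact ⟨r, hr, (⟨n, hn⟩, r), le_rfl, e⟩

theorem forcesMem_check_omega {a : PName P} {p : P} :
    forcesMem a (check P PSet.omega) p ↔
      ∀ q, q ≤ p → ∃ r, r ≤ q ∧ ∃ n, forcesEq a (check P (PSet.ofNat n)) r := by
  constructor
  · intro h q hq
    obtain ⟨r, hr, ⟨n, c⟩, -, e⟩ := h q hq
    exact ⟨r, hr, n.down, e⟩
  · intro h q hq
    obtain ⟨r, hr, n, e⟩ := h q hq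
    exact ⟨r, hr, (⟨n⟩, r), le_rfl, e⟩

theorem forcesMem_check_natSubset_mono {a : PName P} {A B : Set ℕ} (hAB : A ⊆ B) {p : P}
    (h : forcesMem a (check P (natSubset A)) p) : forcesMem a (check P (natSubset B)) p := by
  rw [forcesMem_check_natSubset] at h ⊢
  intro q hq
  obtain ⟨r, hr, n, hn, e⟩ := h q hq
  exact ⟨r, hr, n, hAB hn, e⟩

theorem forcesMem_omega_of_natSubset {a : PName P} {A : Set ℕ} {p : P}
    (h : forcesMem a (check P (natSubset A)) p) : forcesMem a (check P PSet.omega) p := by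
  rw [forcesMem_check_natSubset] at h
  rw [forcesMem_check_omega]
  intro q hq
  obtain ⟨r, hr, n, -, e⟩ := h q hq
  exact ⟨r, hr, n, e⟩

theorem forcesMem_ofNat_natSubset {A : Set ℕ} {n : ℕ} (hn : n ∈ A) (p : P) :
    forcesMem (check P (PSet.ofNat n)) (check P (natSubset A)) p :=
  forcesMem_check_natSubset.2 fun q _ => ⟨q, le_rfl, n, hn, forcesEq_refl _ _⟩

theorem forcesMem_check_ultrafilterSet {V : Ultrafilter ℕ} {a : PName P} {p : P} :
    forcesMem a (check P (ultrafilterSet V)) p ↔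
      ∀ q, q ≤ p → ∃ r, r ≤ q ∧ ∃ A ∈ V, forcesEq a (check P (natSubset A)) r := by
  constructor
  · intro h q hq
    obtain ⟨r, hr, ⟨A, c⟩, -, e⟩ := h q hq
    exact ⟨r, hr, A.1, A.2, e⟩
  · intro h q hq
    obtain ⟨r, hr, A, hA, e⟩ := h q hq
    exact ⟨r, hr, (⟨A, hA⟩, r), le_rfl, e⟩

end PName

/-! ### Preservation reduced to deciding a name on a set in `V` -/

section Forcing

variable {P : Type} [Preorder P]

theorem Forces.mono {φ : ForcingSentence P} {p q : P} (h : q ≤ p) (hp : Forces φ p) :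
    Forces φ q := by
  induction φ generalizing p q with
  | eq a b => exact PName.forcesEq_mono h hp
  | mem a b => exact PName.forcesMem_mono h hp
  | neg φ _ => exact fun r hr => hp r (hr.trans h)
  | and φ ψ ih₁ ih₂ => exact ⟨ih₁ h hp.1, ih₂ h hp.2⟩
  | or φ ψ _ _ => exact fun r hr => hp r (hr.trans h)
  | imp φ ψ _ _ => exact fun r hr => hp r (hr.trans h)
  | all φ ih => exact fun a => ih a h (hp a)
  | ex φ _ => exact fun r hr => hp r (hr.trans h)

/-- Forcing that a name belongs to the filter generated by `V` can be tested on members of `V`. -/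
theorem forces_memGenerated {V : Ultrafilter ℕ} {A : PName P} {p : P} :
    Forces (memGenerated P V A) p ↔ Forces (.sub A (PName.check P PSet.omega)) p ∧
      ∀ q, q ≤ p → ∃ r, r ≤ q ∧ ∃ B ∈ V, Forces (.sub (PName.check P (natSubset B)) A) r := by
  constructor
  · rintro ⟨hA, h⟩
    refine ⟨hA, fun q hq => ?_⟩
    obtain ⟨r, hr, N, hN, hNA⟩ := h q hq
    obtain ⟨s, hs, B, hB, e⟩ := PName.forcesMem_check_ultrafilterSet.1 hN r le_rfl
    refine ⟨s, hs.trans hr, B, hB, fun n t ht hn => ?_⟩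
    exact hNA n t (ht.trans hs)
      (PName.forcesMem_congr_right (PName.forcesEq_symm (PName.forcesEq_mono ht e)) hn)
  · rintro ⟨hA, h⟩
    refine ⟨hA, fun q hq => ?_⟩
    obtain ⟨r, hr, B, hB, hBA⟩ := h q hq
    exact ⟨r, hr, _, PName.forcesMem_check_ultrafilterSet.2
      fun s _ => ⟨s, le_rfl, B, hB, PName.forcesEq_refl _ _⟩, hBA⟩

/-- A forcing notion preserves `V` as soon as every property of natural numbers in the extension
is, densely often, decided uniformly on a member of `V`. -/
theorem preserves_of_decides {V : Ultrafilter ℕ}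
    (H : ∀ (A : PName P) (p : P), ∃ r, r ≤ p ∧ ∃ B ∈ V,
      (∀ b ∈ B, PName.forcesMem (PName.check P (PSet.ofNat b)) A r) ∨
      ∀ b ∈ B, ∀ s, s ≤ r → ¬ PName.forcesMem (PName.check P (PSet.ofNat b)) A s) :
    Preserves P V := by
  intro p
  refine ⟨fun A q _ h => h.1, ?_, ?_, ?_, ?_, ?_⟩
  · rw [forces_memGenerated]
    exact ⟨fun n q _ h => h, fun q _ => ⟨q, le_rfl, Set.univ, Filter.univ_mem,
      fun n r _ h => PName.forcesMem_omega_of_natSubset h⟩⟩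
  · intro A q _ hA r hr hS
    obtain ⟨s, hs, B, hB, hBA⟩ := (forces_memGenerated.1 hS).2 r le_rfl
    obtain ⟨b, hb⟩ := V.nonempty_of_mem hB
    exact hA _ s (hs.trans hr) (hBA _ s le_rfl (PName.forcesMem_ofNat_natSubset hb s))
  · rintro A D q _ ⟨hS, hAD, hD⟩
    rw [forces_memGenerated] at hS ⊢
    refine ⟨hD, fun r hr => ?_⟩
    obtain ⟨s, hs, B, hB, hBA⟩ := hS.2 r hr
    exact ⟨s, hs, B, hB, fun n t ht hn => hAD n t (ht.trans (hs.trans hr)) (hBA n t ht hn)⟩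
  · rintro A B D q _ ⟨⟨hA, hB⟩, hD⟩
    rw [forces_memGenerated] at hA hB ⊢
    refine ⟨fun n r hr hn => hA.1 n r hr ((hD n).1 r hr hn).1, fun r hr => ?_⟩
    obtain ⟨s, hs, X, hX, hXA⟩ := hA.2 r hr
    obtain ⟨t, ht, Y, hY, hYB⟩ := hB.2 s (hs.trans hr)
    refine ⟨t, ht.trans hs, X ∩ Y, Filter.inter_mem hX hY, fun n u hu hn => ?_⟩
    refine (hD n).2 u (hu.trans (ht.trans (hs.trans hr))) ⟨?_, ?_⟩
    · exact hXA n u (hu.trans ht)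
        (PName.forcesMem_check_natSubset_mono Set.inter_subset_left hn)
    · exact hYB n u hu (PName.forcesMem_check_natSubset_mono Set.inter_subset_right hn)
  -- The only clause that needs `H`. A name for an element of `B` equals a canonical numeral only
  -- densely, hence the passage to extensions.
  · rintro A C q _ ⟨hA, hC⟩ r hr
    obtain ⟨s, hs, B, hB, h | h⟩ := H A r
    · refine ⟨s, hs, Or.inl (forces_memGenerated.2
        ⟨Forces.mono (hs.trans hr) hA, fun t ht => ⟨t, le_rfl, B, hB, fun n u hu hn => ?_⟩⟩)⟩
      refine PName.forcesMem_of_dense fun v hv => ?_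
      obtain ⟨w, hw, b, hb, e⟩ := PName.forcesMem_check_natSubset.1 hn v hv
      exact ⟨w, hw, PName.forcesMem_congr_left (PName.forcesEq_symm e)
        (PName.forcesMem_mono (hw.trans (hv.trans (hu.trans ht))) (h b hb))⟩
    · refine ⟨s, hs, Or.inr (forces_memGenerated.2
        ⟨fun n t ht hn => ((hC n).1 t (ht.trans (hs.trans hr)) hn).1,
          fun t ht => ⟨t, le_rfl, B, hB, fun n u hu hn => ?_⟩⟩)⟩
      refine (hC n).2 u (hu.trans (ht.trans (hs.trans hr)))
        ⟨PName.forcesMem_omega_of_natSubset hn, fun v hv hnA => ?_⟩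
      obtain ⟨w, hw, b, hb, e⟩ := PName.forcesMem_check_natSubset.1 hn v hv
      exact h b hb w (hw.trans (hv.trans (hu.trans ht)))
        (PName.forcesMem_congr_left e (PName.forcesMem_mono hw hnA))

end Forcing

/-! ### Selective ultrafilters -/

theorem IsSelective.exists_injOn {U : Ultrafilter ℕ} (hU : IsSelective U) {f : ℕ → ℕ}
    (hf : ∀ c, f ⁻¹' {c} ∉ U) : ∃ A ∈ U, Set.InjOn f A := by
  obtain ⟨A, hA, ⟨c, hc⟩ | h⟩ := hU f
  · exact absurd (Filter.mem_of_superset hA hc) (hf c)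
  · exact ⟨A, hA, h⟩

/-- Send `n` to the least `m` with `n ∉ A m` or `n < m`. This map is not constant on any set in `U`,
hence is injective on some `X ∈ U`, so only finitely many elements of `X` have a value at most `m`.
-/
theorem IsSelective.exists_pseudoIntersection {U : Ultrafilter ℕ} (hU : IsSelective U)
    (hU' : ∀ k, Set.Ici k ∈ U) {A : ℕ → Set ℕ} (hA : ∀ m, A m ∈ U) :
    ∃ X ∈ U, ∃ g : ℕ → ℕ, ∀ m, ∀ l ∈ X, g m ≤ l → l ∈ A m := by
  classical
  have hex : ∀ n, ∃ m, n ∉ A m ∨ n < m := fun n => ⟨n + 1, Or.inr n.lt_succ_self⟩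
  obtain ⟨X, hX, hinj⟩ := hU.exists_injOn (f := fun n => Nat.find (hex n)) (by
    intro c hc
    obtain ⟨n, ⟨hn, hnA⟩, hnc⟩ :=
      U.nonempty_of_mem (Filter.inter_mem (Filter.inter_mem hc (hA c)) (hU' c))
    have hn : Nat.find (hex n) = c := hn
    have := Nat.find_spec (hex n)
    rw [hn] at this
    exact this.elim (fun h => h hnA) (fun h => absurd hnc (not_le.2 h)))
  have hbdd : ∀ m, ∃ b, ∀ l ∈ X, Nat.find (hex l) ≤ m → l ≤ b := by
    intro m
    have hfin : {l ∈ X | Nat.find (hex l) ≤ m}.Finite := by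
      refine Set.Finite.of_finite_image ((Set.finite_Iic m).subset ?_)
        (hinj.mono fun l hl => hl.1)
      rintro _ ⟨l, hl, rfl⟩
      exact hl.2
    obtain ⟨b, hb⟩ := hfin.bddAbove
    exact ⟨b, fun l hl h => hb ⟨hl, h⟩⟩
  choose b hb using hbdd
  refine ⟨X, hX, fun m => b m + 1, fun m l hl hlt => ?_⟩
  by_contra h
  have := hb m l hl (Nat.find_min' _ (Or.inl h))
  exact absurd hlt (not_le.2 (Nat.lt_succ_of_le this))

/-- Otherwise the images of `U` under `φ` and of `V` under `ψ` coincide. Injectivity on `X` and `Y`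
recovers each ultrafilter from its image, making `U` and `V` isomorphic. -/
theorem exists_disjoint_images {U V : Ultrafilter ℕ} (hVU : ¬ RKEquiv V U) {φ ψ : ℕ → ℕ}
    {X Y : Set ℕ} (hX : X ∈ U) (hY : Y ∈ V) (hφ : Set.InjOn φ X) (hψ : Set.InjOn ψ Y) :
    ∃ X' ∈ U, ∃ Y' ∈ V, ∀ x ∈ X', ∀ y ∈ Y', φ x ≠ ψ y := by
  by_contra hcon
  have key : ∀ s, φ ⁻¹' s ∈ U → ψ ⁻¹' s ∈ V := by
    intro s hs
    by_contra h
    refine hcon ⟨_, hs, _, Ultrafilter.compl_mem_iff_notMem.2 h, fun x hx y hy e => hy ?_⟩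
    change ψ y ∈ s
    rw [← e]
    exact hx
  have key' : ∀ s, φ ⁻¹' s ∈ U ↔ ψ ⁻¹' s ∈ V := by
    refine fun s => ⟨key s, fun h => ?_⟩
    by_contra h'
    exact Ultrafilter.compl_mem_iff_notMem.1
      (key sᶜ (Ultrafilter.compl_mem_iff_notMem.2 h')) h
  have inv : ∀ {W : Ultrafilter ℕ} {θ : ℕ → ℕ} {Z : Set ℕ}, Z ∈ W → Set.InjOn θ Z →
      ∀ A, A ∈ W ↔ θ ⁻¹' (Function.invFunOn θ Z ⁻¹' A) ∈ W := by
    intro W θ Z hZ hθ A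
    refine Filter.congr_sets (Filter.mem_of_superset hZ fun z hz => ?_)
    have : Function.invFunOn θ Z (θ z) = z := hθ.leftInvOn_invFunOn hz
    simp [this]
  refine hcon.elim (absurd ⟨⟨Function.invFunOn ψ Y ∘ φ, fun A => ?_⟩,
    ⟨Function.invFunOn φ X ∘ ψ, fun A => ?_⟩⟩ hVU)
  · exact (inv hY hψ A).trans (key' _).symm
  · exact (inv hX hφ A).trans (key' _)

/-- Cut `ℕ` into intervals so long that `g m ≤ l` whenever `l` lies at least two intervals beyond
`m`. Selectivity leaves at most one point per interval, and fixing the parity of the interval index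
separates points of the same set. Non-isomorphism rules out equal or adjacent intervals for points
of different sets. -/
theorem exists_sparse {U V : Ultrafilter ℕ} (hU : IsSelective U) (hV : IsSelective V)
    (hVU : ¬ RKEquiv V U) (hU' : ∀ k, Set.Ici k ∈ U) (hV' : ∀ k, Set.Ici k ∈ V) (g : ℕ → ℕ) :
    ∃ X ∈ U, ∃ Y ∈ V, (∀ m ∈ X ∪ Y, ∀ l ∈ X ∪ Y, m < l → g m ≤ l) ∧ Disjoint X Y := by
  obtain ⟨i, hi₀, hi⟩ : ∃ i : ℕ → ℕ, i 0 = 0 ∧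
      ∀ k, i (k + 1) = i k + 1 + ∑ j ∈ Finset.range (i k + 1), g j :=
    ⟨fun k => Nat.rec 0 (fun _ a => a + 1 + ∑ j ∈ Finset.range (a + 1), g j) k, rfl, fun _ => rfl⟩
  have imono : StrictMono i := strictMono_nat_of_lt_succ fun k => by rw [hi]; omega
  have hig : ∀ k m, m ≤ i k → g m ≤ i (k + 1) := by
    intro k m hm
    have := Finset.single_le_sum (f := g) (fun j _ => Nat.zero_le _)
      (Finset.mem_range.2 (Nat.lt_succ_of_le hm))
    rw [hi]
    simp only [Nat.succ_eq_add_one] at this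
    omega
  let π : ℕ → ℕ := fun n => Nat.findGreatest (fun k => i k ≤ n) n
  have hπ₁ : ∀ n, i (π n) ≤ n := fun n =>
    Nat.findGreatest_spec (P := fun k => i k ≤ n) (Nat.zero_le n) (hi₀.le.trans (Nat.zero_le n))
  have hπ₂ : ∀ n, n < i (π n + 1) := by
    intro n
    by_contra h
    have h' : i (π n + 1) ≤ n := not_lt.1 h
    have : π n + 1 ≤ π n := Nat.le_findGreatest (imono.le_apply.trans h') h'
    omega
  have hπmono : Monotone π := fun m l h => by
    have := imono.lt_iff_lt.1 ((hπ₁ m).trans_lt (h.trans_lt (hπ₂ l)))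
    omega
  have far : ∀ m l, π m + 2 ≤ π l → g m ≤ l := fun m l h =>
    (hig _ m (hπ₂ m).le).trans ((imono.monotone h).trans (hπ₁ l))
  have nice : ∀ {W : Ultrafilter ℕ}, IsSelective W → (∀ k, Set.Ici k ∈ W) →
      ∃ Z ∈ W, Set.InjOn π Z ∧ ∃ e, ∀ z ∈ Z, π z % 2 = e := by
    intro W hW hW'
    obtain ⟨Z, hZ, hinj⟩ := hW.exists_injOn (f := π) (by
      intro c hc
      obtain ⟨n, hn, hn'⟩ := W.nonempty_of_mem (Filter.inter_mem hc (hW' (i (c + 1))))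
      have := hπ₂ n
      rw [show π n = c from hn] at this
      exact absurd hn' (not_le.2 this))
    by_cases hE : {n | π n % 2 = 0} ∈ W
    · exact ⟨_, Filter.inter_mem hZ hE, hinj.mono Set.inter_subset_left, 0, fun z hz => hz.2⟩
    · refine ⟨_, Filter.inter_mem hZ (Ultrafilter.compl_mem_iff_notMem.2 hE),
        hinj.mono Set.inter_subset_left, 1, fun z hz => ?_⟩
      have : ¬ π z % 2 = 0 := hz.2
      omega
  have sep : ∀ {Z : Set ℕ}, Set.InjOn π Z → (∃ e, ∀ z ∈ Z, π z % 2 = e) →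
      ∀ m ∈ Z, ∀ l ∈ Z, m < l → π m + 2 ≤ π l := by
    rintro Z hinj ⟨e, he⟩ m hm l hl hml
    have h1 := hπmono hml.le
    have h2 : π m ≠ π l := fun h => hml.ne (hinj hm hl h)
    have h3 := he m hm
    have h4 := he l hl
    omega
  obtain ⟨X₀, hX₀, hXi, hXe⟩ := nice hU hU'
  obtain ⟨Y₀, hY₀, hYi, hYe⟩ := nice hV hV'
  -- The shifted indices exclude adjacent intervals, in either order.
  have hXi' : Set.InjOn (fun n => π n + 1) X₀ := fun a ha b hb h => hXi ha hb (Nat.succ_injective h)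
  have hYi' : Set.InjOn (fun n => π n + 1) Y₀ := fun a ha b hb h => hYi ha hb (Nat.succ_injective h)
  obtain ⟨X₁, hX₁, Y₁, hY₁, h₁⟩ := exists_disjoint_images hVU hX₀ hY₀ hXi hYi
  obtain ⟨X₂, hX₂, Y₂, hY₂, h₂⟩ := exists_disjoint_images hVU hX₀ hY₀ hXi' hYi
  obtain ⟨X₃, hX₃, Y₃, hY₃, h₃⟩ := exists_disjoint_images hVU hX₀ hY₀ hXi hYi'
  refine ⟨X₀ ∩ (X₁ ∩ (X₂ ∩ X₃)),
      Filter.inter_mem hX₀ (Filter.inter_mem hX₁ (Filter.inter_mem hX₂ hX₃)),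
    Y₀ ∩ (Y₁ ∩ (Y₂ ∩ Y₃)),
      Filter.inter_mem hY₀ (Filter.inter_mem hY₁ (Filter.inter_mem hY₂ hY₃)), ?_, ?_⟩
  · rintro m (⟨m₀, m₁, m₂, m₃⟩ | ⟨m₀, m₁, m₂, m₃⟩) l (⟨l₀, l₁, l₂, l₃⟩ | ⟨l₀, l₁, l₂, l₃⟩) hml
    · exact far m l (sep hXi hXe m m₀ l l₀ hml)
    · have e₁ := h₁ m m₁ l l₁
      have e₂ := h₂ m m₂ l l₂
      have := hπmono hml.le
      exact far m l (by omega)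
    · have e₁ := h₁ l l₁ m m₁
      have e₃ := h₃ l l₃ m m₃
      have := hπmono hml.le
      exact far m l (by omega)
    · exact far m l (sep hYi hYe m m₀ l l₀ hml)
  · rw [Set.disjoint_left]
    rintro n ⟨-, n₁, -⟩ ⟨-, n₂, -⟩
    exact h₁ n n₁ n n₂ rfl

/-- A joint selection principle for two non-isomorphic selective ultrafilters: if every state `s`
of a process offers a set `A s ∈ U` and a set `B s ∈ V`, then members of `U` and `V` can be chosen
so that, running through their elements in increasing order and updating the state at each of
them, every element belongs to the set offered when it is reached. -/
theorem exists_joint_selection {U V : Ultrafilter ℕ} (hU : IsSelective U) (hV : IsSelective V)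
    (hVU : ¬ RKEquiv V U) (hU' : ∀ k, Set.Ici k ∈ U) (hV' : ∀ k, Set.Ici k ∈ V)
    {S : Type*} (init : S) (α β : S → ℕ → S) (A B : S → Set ℕ)
    (hA : ∀ s, A s ∈ U) (hB : ∀ s, B s ∈ V) :
    ∃ X ∈ U, ∃ Y ∈ V, ∃ st : ℕ → S, st 0 = init ∧
      (∀ m ∈ X, m ∈ A (st m) ∧ st (m + 1) = α (st m) m) ∧
      (∀ m ∈ Y, m ∈ B (st m) ∧ st (m + 1) = β (st m) m) ∧
      (∀ m, m ∉ X → m ∉ Y → st (m + 1) = st m) := by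
  classical
  -- `R m` contains every state reachable by time `m`, whatever `X` and `Y` turn out to be, and it
  -- is finite.
  let R : ℕ → Set S := fun n => Nat.rec {init}
    (fun m r => r ∪ ((fun s => α s m) '' r ∪ (fun s => β s m) '' r)) n
  have hR : ∀ m, R (m + 1) = R m ∪ ((fun s => α s m) '' R m ∪ (fun s => β s m) '' R m) :=
    fun m => rfl
  have hfin : ∀ m, (R m).Finite := by
    intro m
    induction m with
    | zero => exact Set.finite_singleton _
    | succ m ih => rw [hR]; exact ih.union ((ih.image _).union (ih.image _))
  obtain ⟨X₀, hX₀, g₁, hg₁⟩ := hU.exists_pseudoIntersection hU' (A := fun m => ⋂ s ∈ R m, A s)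
    fun m => (Filter.biInter_mem (hfin m)).2 fun s _ => hA s
  obtain ⟨Y₀, hY₀, g₂, hg₂⟩ := hV.exists_pseudoIntersection hV' (A := fun m => ⋂ s ∈ R m, B s)
    fun m => (Filter.biInter_mem (hfin m)).2 fun s _ => hB s
  -- The shift to `m + 1` reflects that the update at `m` produces a state in `R (m + 1)`.
  obtain ⟨X₁, hX₁, Y₁, hY₁, hsp, hdisj⟩ :=
    exists_sparse hU hV hVU hU' hV' fun m => max (g₁ (m + 1)) (g₂ (m + 1))
  let X := X₁ ∩ (X₀ ∩ Set.Ici (max (g₁ 0) (g₂ 0)))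
  let Y := Y₁ ∩ (Y₀ ∩ Set.Ici (max (g₁ 0) (g₂ 0)))
  let st : ℕ → S := fun n => Nat.rec init
    (fun m s => if m ∈ X then α s m else if m ∈ Y then β s m else s) n
  have hst : ∀ m, st (m + 1) =
      if m ∈ X then α (st m) m else if m ∈ Y then β (st m) m else st m := fun m => rfl
  have hstR : ∀ m, st m ∈ R m := by
    intro m
    induction m with
    | zero => exact rfl
    | succ m ih =>
      rw [hst, hR]
      split_ifs
      · exact Or.inr (Or.inl ⟨_, ih, rfl⟩)
      · exact Or.inr (Or.inr ⟨_, ih, rfl⟩)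
      · exact Or.inl ih
  have hXY : X ∪ Y ⊆ X₁ ∪ Y₁ := Set.union_subset_union Set.inter_subset_left Set.inter_subset_left
  -- The state is constant between elements of `X ∪ Y`, so `m` can be taken just after the last such
  -- element before `l`, or `0` if there is none.
  have key : ∀ l, ∃ m, st l ∈ R m ∧ ∀ l' ∈ X ∪ Y, l ≤ l' → max (g₁ m) (g₂ m) ≤ l' := by
    intro l
    induction l with
    | zero =>
      refine ⟨0, hstR 0, ?_⟩
      rintro l' (h | h) -
      · exact h.2.2
      · exact h.2.2
    | succ l ih =>
      by_cases hl : l ∈ X ∪ Y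
      · exact ⟨l + 1, hstR (l + 1), fun l' hl' hlt => hsp l (hXY hl) l' (hXY hl') hlt⟩
      · obtain ⟨m, hm, h⟩ := ih
        refine ⟨m, ?_, fun l' hl' hlt => h l' hl' (by omega)⟩
        rw [hst, if_neg fun h => hl (Or.inl h), if_neg fun h => hl (Or.inr h)]
        exact hm
  refine ⟨X, Filter.inter_mem hX₁ (Filter.inter_mem hX₀ (hU' _)),
    Y, Filter.inter_mem hY₁ (Filter.inter_mem hY₀ (hV' _)), st, rfl, ?_, ?_, ?_⟩
  · intro l hl
    obtain ⟨m, hm, h⟩ := key l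
    refine ⟨?_, by rw [hst, if_pos hl]⟩
    have := hg₁ m l hl.2.1 ((le_max_left _ _).trans (h l (Or.inl hl) le_rfl))
    exact Set.mem_iInter₂.1 this _ hm
  · intro l hl
    obtain ⟨m, hm, h⟩ := key l
    refine ⟨?_, by rw [hst, if_neg fun h => Set.disjoint_left.1 hdisj h.1 hl.1, if_pos hl]⟩
    have := hg₂ m l hl.2.1 ((le_max_right _ _).trans (h l (Or.inr hl) le_rfl))
    exact Set.mem_iInter₂.1 this _ hm
  · intro m h₁ h₂
    rw [hst, if_neg h₁, if_neg h₂]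

/-! ### Operations on `U`-conditions -/

theorem IsBig.mono_set {l k : ℕ} {A B : Set (Fin l → Bool)} (hAB : A ⊆ B) (h : IsBig k A) :
    IsBig k B := fun σ => let ⟨τ, hτ, e⟩ := h σ; ⟨τ, hAB hτ, e⟩

theorem IsBig.of_le {l k k' : ℕ} {A : Set (Fin l → Bool)} (hk : k ≤ k') (h : IsBig k' A) :
    IsBig k A := by
  intro σ
  obtain ⟨τ, hτ, hl, e⟩ := h fun i => if hi : (i : ℕ) < k then σ ⟨i, hi⟩ else false
  refine ⟨τ, hτ, hk.trans hl, fun i => ?_⟩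
  have := e (Fin.castLE hk i)
  simpa using this

theorem TreeNode.restrict_append {l m : ℕ} (h : m ≤ l) (f : TreeNode l) (σ : Fin l → Bool) :
    (f.append σ).restrict (h.trans l.le_succ) = f.restrict h := by
  funext k
  exact Fin.snoc_castSucc (α := fun k : Fin (l + 1) => Fin (k : ℕ) → Bool) σ f (Fin.castLE h k)

namespace UCondition

variable {U : Ultrafilter ℕ}

theorem exists_extension (T : UCondition U) {l n : ℕ} (h : l ≤ n) {f : TreeNode l}
    (hf : f ∈ T.tree l) : ∃ g ∈ T.tree n, g.restrict h = f := by
  obtain ⟨m, _, hn, g, hg, e⟩ := T.extend l f hf n h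
  exact ⟨g.restrict hn, T.downward_closed hn g hg, e⟩

theorem level_nonempty (T : UCondition U) (n : ℕ) : (T.tree n).Nonempty :=
  let ⟨g, hg, _⟩ := T.exists_extension n.zero_le T.root_mem
  ⟨g, hg⟩

theorem Ici_mem (T : UCondition U) (k : ℕ) : Set.Ici k ∈ U := by
  refine Filter.mem_of_superset (T.big k) fun l hl => ?_
  obtain ⟨f, hf⟩ := T.level_nonempty l
  obtain ⟨-, -, h, -⟩ := hl f hf fun _ => false
  exact h

/-- The subtree of the nodes of `T` that are comparable with `f`. -/
def cone (T : UCondition U) {F : ℕ} (f : TreeNode F) (hf : f ∈ T.tree F) : UCondition U where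
  tree l := {g | ∃ m, ∃ hl : l ≤ m, ∃ hF : F ≤ m, ∃ g' ∈ T.tree m,
    g'.restrict hl = g ∧ g'.restrict hF = f}
  downward_closed := by
    rintro l m h _ ⟨n, hm, hF, g', hg', rfl, e⟩
    exact ⟨n, h.trans hm, hF, g', hg', rfl, e⟩
  root_mem := ⟨F, F.zero_le, le_rfl, f, hf, funext fun k => k.elim0, rfl⟩
  extend := by
    rintro l _ ⟨m, hl, hF, g', hg', rfl, e⟩ n hn
    obtain ⟨g, hg, rfl⟩ := T.exists_extension (le_max_left m n) hg'
    exact ⟨max m n, hl.trans (le_max_left _ _), le_max_right _ _, g,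
      ⟨max m n, le_rfl, hF.trans (le_max_left _ _), g, hg, rfl, e⟩, rfl⟩
  big k := by
    refine Filter.mem_of_superset (Filter.inter_mem (T.big k) (T.Ici_mem F)) ?_
    rintro l ⟨hl, hF⟩ _ ⟨m, hlm, hFm, g', hg', rfl, e⟩
    refine (hl _ (T.downward_closed hlm g' hg')).mono_set fun σ hσ => ?_
    refine ⟨l + 1, le_rfl, le_trans hF l.le_succ, _, hσ, rfl, ?_⟩
    rw [TreeNode.restrict_append hF]
    exact e

theorem cone_le (T : UCondition U) {F : ℕ} {f : TreeNode F} (hf : f ∈ T.tree F) :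
    T.cone f hf ≤ T := by
  rintro l _ ⟨m, hl, -, g', hg', rfl, -⟩
  exact T.downward_closed hl g' hg'

theorem restrict_of_mem_cone (T : UCondition U) {F l : ℕ} {f : TreeNode F} (hf : f ∈ T.tree F)
    {g : TreeNode l} (hg : g ∈ (T.cone f hf).tree l) (h : F ≤ l) : g.restrict h = f := by
  obtain ⟨m, hl, hF, g', -, rfl, rfl⟩ := hg
  rfl

/-- The union of finitely many conditions. -/
def iUnion {ι : Type*} [Finite ι] [Nonempty ι] (T : ι → UCondition U) : UCondition U where
  tree l := ⋃ i, (T i).tree l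
  downward_closed := by
    intro l m h g hg
    obtain ⟨i, hi⟩ := Set.mem_iUnion.1 hg
    exact Set.mem_iUnion.2 ⟨i, (T i).downward_closed h g hi⟩
  root_mem := Set.mem_iUnion.2 ⟨Classical.arbitrary ι, (T _).root_mem⟩
  extend := by
    intro l f hf n hn
    obtain ⟨i, hi⟩ := Set.mem_iUnion.1 hf
    obtain ⟨m, h, hm, g, hg, e⟩ := (T i).extend l f hi n hn
    exact ⟨m, h, hm, g, Set.mem_iUnion.2 ⟨i, hg⟩, e⟩
  big k := by
    refine Filter.mem_of_superset (Filter.iInter_mem.2 fun i => (T i).big k) ?_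
    intro l hl f hf
    obtain ⟨i, hi⟩ := Set.mem_iUnion.1 hf
    exact (Set.mem_iInter.1 hl i f hi).mono_set fun σ hσ => Set.mem_iUnion.2 ⟨i, hσ⟩

/-- If below each node of level `F` of `T` some condition has the open property `φ`, then `T` can
be shrunk above level `F` so that `φ` holds densely below the result. -/
theorem exists_amalgam (T : UCondition U) (F : ℕ) {φ : UCondition U → Prop}
    (hmono : ∀ {p q}, q ≤ p → φ p → φ q)
    (h : ∀ f, ∀ hf : f ∈ T.tree F, ∃ S, S ≤ T.cone f hf ∧ φ S) :
    ∃ T' : UCondition U, T' ≤ T ∧ (∀ l ≤ F, T.tree l ⊆ T'.tree l) ∧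
      ∀ q, q ≤ T' → ∃ r, r ≤ q ∧ φ r := by
  choose S hS hφ using h
  have : Nonempty (T.tree F) := (T.level_nonempty F).to_subtype
  refine ⟨iUnion fun f : T.tree F => S f.1 f.2, ?_, ?_, ?_⟩
  · intro l g hg
    obtain ⟨f, hf⟩ := Set.mem_iUnion.1 hg
    exact T.cone_le f.2 l (hS _ _ l hf)
  · intro l hl g hg
    obtain ⟨f, hf, rfl⟩ := T.exists_extension hl hg
    obtain ⟨f', hf'⟩ := (S f hf).level_nonempty F
    obtain rfl : f' = f := T.restrict_of_mem_cone hf (hS f hf F hf') le_rfl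
    exact Set.mem_iUnion.2 ⟨⟨f', hf⟩, (S f' hf).downward_closed hl f' hf'⟩
  · intro q hq
    obtain ⟨f, hf⟩ := q.level_nonempty F
    -- Distinct pieces `S f` have disjoint parts above level `F`, so a node of `q` above `f` can
    -- only come from `S f`.
    have mem : ∀ {m : ℕ} (hm : F ≤ m) (g : TreeNode m), g ∈ q.tree m → g.restrict hm = f →
        ∃ hf : f ∈ T.tree F, g ∈ (S f hf).tree m := by
      rintro m hm g hg rfl
      obtain ⟨f', hf'⟩ := Set.mem_iUnion.1 (hq m hg)
      have e := T.restrict_of_mem_cone f'.2 (hS _ _ m hf') hm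
      obtain ⟨f', h'⟩ := f'
      subst e
      exact ⟨h', hf'⟩
    obtain ⟨hfT, -⟩ := mem le_rfl f hf rfl
    refine ⟨q.cone f hf, q.cone_le hf, hmono ?_ (hφ f hfT)⟩
    rintro l _ ⟨m, hl, hF, g, hg, rfl, e⟩
    obtain ⟨_, hgS⟩ := mem hF g hg e
    exact (S f hfT).downward_closed hl g hgS

/-- The fusion of a decreasing sequence of conditions, in which the levels up to `F m` are not
changed after stage `m`. -/
theorem exists_fusion (T : ℕ → UCondition U) (F : ℕ → ℕ)
    (hT : ∀ m, T (m + 1) ≤ T m) (hF : Monotone F)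
    (hTF : ∀ m, ∀ l ≤ F m, (T m).tree l ⊆ (T (m + 1)).tree l)
    (hunb : ∀ k, ∃ m, k ≤ F m) {X : Set ℕ} (hX : X ∈ U)
    (hbig : ∀ a ∈ X, T (a + 1) = T a ∧ F (a + 1) = a + 1 ∧
      ∀ f ∈ (T a).tree a, IsBig (F a) (treeSucc (T a).tree f)) :
    ∃ q : UCondition U, ∀ m, q ≤ T m := by
  have hanti : Antitone T := antitone_nat_of_succ_le hT
  have hfreeze : ∀ m n, ∀ l ≤ F m, (T m).tree l ⊆ (T n).tree l := by
    intro m n l hl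
    rcases le_total m n with h | h
    · induction n, h using Nat.le_induction with
      | base => exact subset_rfl
      | succ n hn ih => exact ih.trans (hTF n l (hl.trans (hF hn)))
    · exact hanti h l
  have hmem : ∀ m, ∀ l ≤ F m, (T m).tree l ⊆ ⋂ n, (T n).tree l :=
    fun m l hl => Set.subset_iInter fun n => hfreeze m n l hl
  refine ⟨⟨fun l => ⋂ n, (T n).tree l, ?_, ?_, ?_, ?_⟩, fun m l => Set.iInter_subset _ m⟩
  · exact fun h g hg => Set.mem_iInter.2 fun n =>
      (T n).downward_closed h g (Set.mem_iInter.1 hg n)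
  · exact Set.mem_iInter.2 fun n => (T n).root_mem
  · intro l f hf n hn
    obtain ⟨m, hm⟩ := hunb n
    obtain ⟨g, hg, e⟩ := (T m).exists_extension hn (Set.mem_iInter.1 hf m)
    exact ⟨n, hn, le_rfl, g, hmem m n hm hg, e⟩
  · intro k
    obtain ⟨m, hm⟩ := hunb k
    refine Filter.mem_of_superset (Filter.inter_mem hX ((T 0).Ici_mem m)) ?_
    rintro a ⟨ha, hma⟩ f hf
    -- Level `a + 1` is frozen before `T a` changes, so `q` retains all successors that nodes of
    -- level `a` have in `T a`.
    obtain ⟨h₁, h₂, h₃⟩ := hbig a ha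
    refine ((h₃ f (Set.mem_iInter.1 hf a)).of_le (hm.trans (hF hma))).mono_set fun σ hσ => ?_
    refine hmem (a + 1) (a + 1) h₂.ge ?_
    rw [h₁]
    exact hσ

/-- Every open property of conditions depending on `n : ℕ` is, densely often, decided uniformly on
a member of `V`. -/
theorem decides {V : Ultrafilter ℕ} (hU : IsSelective U) (hV : IsSelective V)
    (hVU : ¬ RKEquiv V U) {φ : ℕ → UCondition U → Prop}
    (hmono : ∀ n {p q}, q ≤ p → φ n p → φ n q)
    (hdense : ∀ n p, (∀ q, q ≤ p → ∃ r, r ≤ q ∧ φ n r) → φ n p) (p : UCondition U) :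
    ∃ r, r ≤ p ∧ ∃ B ∈ V, (∀ b ∈ B, φ b r) ∨ ∀ b ∈ B, ∀ s, s ≤ r → ¬ φ b s := by
  classical
  by_cases hpr : ∃ k, Set.Ici k ∉ V
  -- A principal `V` contains some `{n}`, and a single `n` is decided directly.
  · obtain ⟨k, hk⟩ := hpr
    have hfin : (Set.Ici k)ᶜ.Finite := by
      rw [Set.compl_Ici]
      exact Set.finite_Iio k
    obtain ⟨n, -, hn⟩ := Ultrafilter.eq_pure_of_finite_mem hfin
      (Ultrafilter.compl_mem_iff_notMem.2 hk)
    have hB : {n} ∈ V := by rw [hn]; exact Set.mem_singleton n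
    by_cases h : ∃ r, r ≤ p ∧ φ n r
    · obtain ⟨r, hr, h⟩ := h
      exact ⟨r, hr, {n}, hB, Or.inl fun b hb => by rwa [Set.mem_singleton_iff.1 hb]⟩
    · refine ⟨p, le_rfl, {n}, hB, Or.inr fun b hb s hs h' => h ⟨s, hs, ?_⟩⟩
      rwa [← Set.mem_singleton_iff.1 hb]
  have hV' : ∀ k, Set.Ici k ∈ V := fun k => by_contra fun h => hpr ⟨k, h⟩
  by_cases hcase : ∃ r, r ≤ p ∧ {b | ∀ s, s ≤ r → ¬ φ b s} ∈ V
  · obtain ⟨r, hr, h⟩ := hcase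
    exact ⟨r, hr, _, h, Or.inr fun b hb => hb⟩
  have hpos : ∀ r, r ≤ p → {b | ∃ s, s ≤ r ∧ φ b s} ∈ V := by
    intro r hr
    by_contra h
    refine hcase ⟨r, hr, Filter.mem_of_superset (Ultrafilter.compl_mem_iff_notMem.2 h) ?_⟩
    exact fun b hb s hs hφ => hb ⟨s, hs, hφ⟩
  let good : {T // T ≤ p} × ℕ → ℕ → {T // T ≤ p} → Prop := fun s b T =>
    T.1 ≤ s.1.1 ∧ (∀ l ≤ s.2, s.1.1.tree l ⊆ T.1.tree l) ∧ φ b T.1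
  obtain ⟨X, hX, Y, hY, st, -, hstX, hstY, hst⟩ := exists_joint_selection hU hV hVU
    p.Ici_mem hV' ((⟨p, le_rfl⟩, 0) : {T // T ≤ p} × ℕ)
    (fun s a => (s.1, a + 1))
    -- The `else` value is never used at stages in `Y`, since the set offered to `V` consists of
    -- those `b` for which a good tree exists.
    (fun s b => if h : ∃ T, good s b T then (h.choose, s.2) else s)
    -- The requirement `s.2 ≤ a` makes the frozen height nondecreasing.
    (fun s => {a | s.2 ≤ a ∧ ∀ f ∈ s.1.1.tree a, IsBig s.2 (treeSucc s.1.1.tree f)})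
    (fun s => {b | ∃ T, good s b T})
    (fun s => Filter.inter_mem (p.Ici_mem _) (s.1.1.big s.2))
    (by
      intro s
      -- Level `s.2` is finite, so one set in `V` serves all its nodes at once.
      have : (⋂ f : s.1.1.tree s.2, {b | ∃ S, S ≤ s.1.1.cone f.1 f.2 ∧ φ b S}) ∈ V :=
        Filter.iInter_mem.2 fun f => hpos _ ((s.1.1.cone_le f.2).trans s.1.2)
      refine Filter.mem_of_superset this fun b hb => ?_
      obtain ⟨T, h₁, h₂, h₃⟩ := s.1.1.exists_amalgam s.2 (hmono b)
        fun f hf => Set.mem_iInter.1 hb ⟨f, hf⟩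
      exact ⟨⟨T, h₁.trans s.1.2⟩, h₁, h₂, hdense b T h₃⟩)
  have hY' : ∀ b ∈ Y, good (st b) b (st (b + 1)).1 ∧ (st (b + 1)).2 = (st b).2 := by
    intro b hb
    obtain ⟨h, e⟩ := hstY b hb
    have h : ∃ T, good (st b) b T := h
    rw [e, dif_pos h]
    exact ⟨h.choose_spec, rfl⟩
  have step : ∀ m, (st (m + 1)).1.1 ≤ (st m).1.1 ∧ (st m).2 ≤ (st (m + 1)).2 ∧
      ∀ l ≤ (st m).2, (st m).1.1.tree l ⊆ (st (m + 1)).1.1.tree l := by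
    intro m
    by_cases hmX : m ∈ X
    · obtain ⟨h, e⟩ := hstX m hmX
      rw [e]
      exact ⟨le_rfl, h.1.trans m.le_succ, fun l _ => subset_rfl⟩
    by_cases hmY : m ∈ Y
    · obtain ⟨h, e⟩ := hY' m hmY
      exact ⟨h.1, e.ge, h.2.1⟩
    · rw [hst m hmX hmY]
      exact ⟨le_rfl, le_rfl, fun l _ => subset_rfl⟩
  obtain ⟨q, hq⟩ := exists_fusion (fun m => (st m).1.1) (fun m => (st m).2)
    (fun m => (step m).1) (monotone_nat_of_le_succ fun m => (step m).2.1)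
    (fun m => (step m).2.2)
    (by
      intro k
      obtain ⟨a, ha, hka⟩ := U.nonempty_of_mem (Filter.inter_mem hX (p.Ici_mem k))
      refine ⟨a + 1, ?_⟩
      rw [(hstX a ha).2]
      exact le_trans hka a.le_succ)
    hX
    (by
      intro a ha
      obtain ⟨h, e⟩ := hstX a ha
      rw [e]
      exact ⟨rfl, rfl, h.2⟩)
  exact ⟨q, (hq 0).trans (st 0).1.2, Y, hY,
    Or.inl fun b hb => hmono b (hq (b + 1)) (hY' b hb).1.2.2⟩

end UCondition

theorem mainTheorem8 (U V : Ultrafilter ℕ) (hU : IsSelective U) (hV : IsSelective V)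
    (hVU : ¬ RKEquiv V U) : Preserves (UCondition U) V :=
  preserves_of_decides fun A p => UCondition.decides hU hV hVU
    (φ := fun n q => PName.forcesMem (PName.check _ (PSet.ofNat n)) A q)
    (fun _ _ _ h => PName.forcesMem_mono h) (fun _ _ => PName.forcesMem_of_dense) p
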